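/- Let $d\ge 1$ and let $\mathcal Q$ be the compact convex set of quantum channels on $\mathbb C^d$, i.e. of the linear maps $\rho\mapsto\sum_l A_l\rho A_l^\dagger$ on $d\times d$ complex matrices with $\sum_l A_l^\dagger A_l=I$. Let $\mathrm{ri}(\mathcal Q)$ be its relative interior (the interior in its affine hull) and $\partial\mathcal Q=\mathcal Q\setminus\mathrm{ri}(\mathcal Q)$. For $\mathcal F\in\mathcal Q$, the boundariness of $\mathcal F$ is $$b(\mathcal F)=1-\sup\,\max_j \pi_j ,$$ where the supremum is over all finite convex decompositions $\mathcal F=\sum_j\pi_j\mathcal X_j$ ($0\le\pi_j\le1$, $\sum_j\pi_j=1$) with all $\mathcal X_j\in\partial\mathcal Q$ (the supremum of the empty set, which occurs only for $d=1$, is $0$). The Choi–Jamiołkowski operator of $\mathcal E$ is $$J_{\mathcal E}=(\mathcal E\otimes\mathcal I)[\Psi_+],\qquad \Psi_+=\frac1d\sum_{j,k=1}^d|jj\rangle\langle kk| .$$ For a unitary $d\times d$ matrix $U$ let $\mathcal U$ be the unitary channel $\rho\mapsto U\rho U^\dagger$ and $|U\rangle\!\rangle=(U\otimes I)\sum_{j}|jj\rangle$.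 Write $\lambda_1(X)$ for the largest eigenvalue of a matrix $X$ all of whose eigenvalues are real. Theorem. Let $\mathcal F\in\mathrm{ri}(\mathcal Q)$. Then $J_{\mathcal F}$ is invertible; for every unitary $U$ all the eigenvalues of $J_{\mathcal F}^{-1}J_{\mathcal U}$ are real and $\langle\!\langle U|J_{\mathcal F}^{-1}|U\rangle\!\rangle$ is real; the maxima below, over all unitary $d\times d$ matrices $U$, exist and are positive; and $$b(\mathcal F)=\Big[\max_{U}\lambda_1\big(J_{\mathcal F}^{-1}J_{\mathcal U}\big)\Big]^{-1}=\frac{d}{\max_U\langle\!\langle U|J_{\mathcal F}^{-1}|U\rangle\!\rangle}.$$ Moreover, if $\mathcal F=b(\mathcal F)\,\mathcal E+(1-b(\mathcal F))\,\mathcal G$ for some $\mathcal E\in\mathcal Q$ and $\mathcal G\in\partial\mathcal Q$, then $\mathcal E$ is a unitary channel. -/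

import Mathlib

open scoped Kronecker Matrix

noncomputable section

/-! ## Compact convex sets: boundary points and boundariness -/

/-- The boundary `∂B = B \ ri(B)` of a convex set `B`: the points of `B` that are not interior
relative to the affine hull of `B`. -/
def relBoundary {V : Type*} [AddCommGroup V] [Module ℝ V] [TopologicalSpace V]
    (B : Set V) : Set V :=
  B \ intrinsicInterior ℝ B

/-- The maximal weights `max_j π_j` of all the finite convex decompositions `y = ∑ π_j x_j`
of `y` into boundary points `x_j ∈ ∂B`. -/
def boundaryWeights {V : Type*} [AddCommGroup V] [Module ℝ V] [TopologicalSpace V]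
    (B : Set V) (y : V) : Set ℝ :=
  {w | ∃ (m : ℕ) (p : Fin m → ℝ) (x : Fin m → V),
      (∀ j, 0 ≤ p j ∧ p j ≤ 1) ∧ ∑ j, p j = 1 ∧ (∀ j, x j ∈ relBoundary B) ∧
      y = ∑ j, p j • x j ∧ IsGreatest (Set.range p) w}

/-- The boundariness `b(y) = 1 - sup max_j π_j`, the supremum being over all the finite convex
decompositions of `y` into boundary points of `B`. All the weights lie in `[0, 1]`. -/
def boundariness {V : Type*} [AddCommGroup V] [Module ℝ V] [TopologicalSpace V]
    (B : Set V) (y : V) : ℝ :=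
  1 - sSup (boundaryWeights B y)

/-! ## Quantum channels -/

/-- Operators on `ℂ^d`, as matrices in the standard orthonormal basis. -/
abbrev Op (d : ℕ) : Type := Matrix (Fin d) (Fin d) ℂ

/-- Linear maps on operators on `ℂ^d`. In finite dimension every linear map is continuous; the
bundled continuous maps are used because they carry the usual topology. -/
abbrev SuperOp (d : ℕ) : Type := Op d →L[ℂ] Op d

/-- The set of quantum channels on `ℂ^d`: the maps `ρ ↦ ∑ A_l ρ A_l†` with `∑ A_l† A_l = I`. -/
def channels (d : ℕ) : Set (SuperOp d) :=
  {Φ | ∃ (m : ℕ) (A : Fin m → Op d), ∑ l, (A l)ᴴ * A l = 1 ∧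
      ∀ X : Op d, Φ X = ∑ l, A l * X * (A l)ᴴ}

/-- The map `X ↦ U X U†`; for a unitary `U` it is a unitary channel. -/
def conjMap {d : ℕ} (U : Op d) : SuperOp d where
  toFun X := U * X * Uᴴ
  map_add' X Y := by rw [Matrix.mul_add, Matrix.add_mul]
  map_smul' c X := by simp
  cont := by fun_prop

/-- The Choi–Jamiołkowski operator `J_Φ = (Φ ⊗ id)[Ψ₊]`, with
`Ψ₊ = (1/d) ∑_{j,k} |jj⟩⟨kk| = (1/d) ∑_{j,k} |j⟩⟨k| ⊗ |j⟩⟨k|`. -/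
def choi {d : ℕ} (Φ : SuperOp d) : Matrix (Fin d × Fin d) (Fin d × Fin d) ℂ :=
  (1 / (d : ℂ)) • ∑ j, ∑ k, Φ (Matrix.single j k 1) ⊗ₖ (Matrix.single j k 1 : Op d)

/-- The vector `|U⟩⟩ = (U ⊗ I) ∑_j |jj⟩` of `ℂ^d ⊗ ℂ^d`. -/
def vecOf {d : ℕ} (U : Op d) : Fin d × Fin d → ℂ :=
  (U ⊗ₖ (1 : Op d)) *ᵥ ∑ j, Pi.single (j, j) 1

/-- `⟨v| A |v⟩`. -/
def sandwich {ι : Type*} [Fintype ι] (A : Matrix ι ι ℂ) (v : ι → ℂ) : ℂ :=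
  star v ⬝ᵥ (A *ᵥ v)

/-- `l` is the maximal eigenvalue `λ₁(X)`: it is an eigenvalue of `X`, and all the (complex)
eigenvalues of `X` are real and at most `l`. -/
def IsMaxEigenvalue {ι : Type*} [Fintype ι] [DecidableEq ι] (X : Matrix ι ι ℂ) (l : ℝ) : Prop :=
  Module.End.HasEigenvalue (Matrix.toLin' X) (l : ℂ) ∧
    ∀ z : ℂ, Module.End.HasEigenvalue (Matrix.toLin' X) z → z.im = 0 ∧ z.re ≤ l

end

/-!
Write `J` for the Choi matrix of `F`, and let `U` maximize the form `A ↦ ⟨⟨A|J⁻¹|A⟩⟩` over the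
contractions, `AᴴA ≤ 1`. The form is strictly convex, so its maximizers are extreme points, and the
extreme contractions are the unitaries.

A channel lies on the boundary exactly when its Choi matrix is singular. Hence if
`F = (1 - t) G + t E` with `G` on the boundary, the matrix `K = t J_E` agrees with `J` on some
`v ≠ 0`, which can be scaled so that `⟨v|J|v⟩ = d / t`. With `|A⟩⟩ = J v = K v`, the Cauchy–Schwarz
inequality for `K` says `t J_A ≤ K`, where `J_A` is the Choi matrix of `ρ ↦ A ρ Aᴴ`, and its partial
trace says that `A` is a contraction. Thus `d / t = ⟨⟨A|J⁻¹|A⟩⟩ ≤ ⟨⟨U|J⁻¹|U⟩⟩`. In the case of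
equality `A` is unitary, and comparing traces gives `E = ρ ↦ A ρ Aᴴ`.

Conversely, for `b = d / ⟨⟨U|J⁻¹|U⟩⟩` the matrix `J - b J_U` is positive semidefinite and kills
`J⁻¹|U⟩⟩`, so `F` is a mixture of the unitary channel with weight `b` and a boundary channel.
-/

open scoped ComplexOrder MatrixOrder Topology

theorem eventually_nonneg_of_isStrictlyPositive {A : Type*} [CStarAlgebra A] [PartialOrder A]
    [StarOrderedRing A] {a : A} (ha : IsStrictlyPositive a) :
    ∀ᶠ b in 𝓝 a, IsSelfAdjoint b → 0 ≤ b := by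
  nontriviality A
  obtain ⟨r, hr, hra⟩ := (CFC.exists_pos_algebraMap_le_iff ha.isSelfAdjoint).mpr fun _ hx =>
    ha.spectrum_pos hx
  filter_upwards [Metric.ball_mem_nhds a hr] with b hb hsa
  have hdist : a - b ≤ algebraMap ℝ A r :=
    (ha.isSelfAdjoint.sub hsa).le_algebraMap_norm_self.trans <|
      algebraMap_mono A (by simpa [dist_eq_norm, norm_sub_rev] using (Metric.mem_ball.mp hb).le)
  simpa using sub_le_sub hra hdist

theorem exists_pos_add_smul_sub_mem {V : Type*} [AddCommGroup V] [Module ℝ V]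
    [TopologicalSpace V] [IsTopologicalAddGroup V] [ContinuousSMul ℝ V] {B : Set V} {x y : V}
    (hx : x ∈ intrinsicInterior ℝ B) (hy : y ∈ B) : ∃ ε : ℝ, 0 < ε ∧ x + ε • (x - y) ∈ B := by
  obtain ⟨z, hz, rfl⟩ := mem_intrinsicInterior.mp hx
  let line (t : ℝ) : affineSpan ℝ B :=
    ⟨AffineMap.lineMap y (z : V) (1 + t),
      AffineMap.lineMap_mem _ (subset_affineSpan ℝ B hy) z.2⟩
  have hline (t : ℝ) : (line t : V) = z + t • (z - y) := by
    simp only [line, AffineMap.lineMap_apply_module]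
    module
  have hcont : Continuous line :=
    Continuous.subtype_mk (by fun_prop) _
  have hline_zero : line 0 = z := Subtype.ext (by simp [hline])
  have hnhds : ∀ᶠ t in 𝓝 (0 : ℝ), line t ∈ ((↑) ⁻¹' B : Set (affineSpan ℝ B)) :=
    hcont.continuousAt.preimage_mem_nhds (by rwa [hline_zero, mem_interior_iff_mem_nhds] at *)
  obtain ⟨ε, hε, hεB⟩ := ((hnhds.filter_mono nhdsWithin_le_nhds).and
    (self_mem_nhdsWithin : Set.Ioi (0 : ℝ) ∈ 𝓝[>] 0)).exists.imp fun t ht => ht.symm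
  exact ⟨ε, hε, hline ε ▸ hεB⟩

theorem mem_extremePoints_of_isMaxOn {E : Type*} [AddCommGroup E] [Module ℝ E] {s t : Set E}
    {f : E → ℝ} {x : E} (hf : StrictConvexOn ℝ t f) (hst : s ⊆ t) (hx : x ∈ s)
    (hmax : IsMaxOn f s x) : x ∈ s.extremePoints ℝ := by
  refine ⟨hx, fun y hy z hz hyz => ?_⟩
  by_contra hne
  have hne' : y ≠ z := by
    rintro rfl
    simp_all
  exact (hf.lt_on_openSegment (hst hy) (hst hz) hne' hyz).not_ge (max_le (hmax hy) (hmax hz))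

section QuadraticForms

variable {ι : Type*} [Fintype ι]

theorem sandwich_eq_ofReal {A : Matrix ι ι ℂ} (hA : A.IsHermitian) (v : ι → ℂ) :
    sandwich A v = ((sandwich A v).re : ℂ) :=
  Complex.ext rfl (by simpa using! hA.im_star_dotProduct_mulVec_self v)

theorem exists_pos_dotProduct_star_self_eq {v : ι → ℂ} (hv : v ≠ 0) :
    ∃ n : ℝ, 0 < n ∧ star v ⬝ᵥ v = n := by
  have h := Matrix.dotProduct_star_self_pos_iff.mpr hv
  exact ⟨_, (Complex.pos_iff.mp h).1, Complex.ext rfl (Complex.pos_iff.mp h).2.symm⟩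

theorem mulVec_inv_mulVec [DecidableEq ι] {A : Matrix ι ι ℂ} (hA : IsUnit A) (v : ι → ℂ) :
    A *ᵥ A⁻¹ *ᵥ v = v := by
  rw [Matrix.mulVec_mulVec, Matrix.mul_nonsing_inv _ ((Matrix.isUnit_iff_isUnit_det _).mp hA),
    Matrix.one_mulVec]

theorem sandwich_inv_mulVec [DecidableEq ι] {A : Matrix ι ι ℂ} (hA : A.PosDef) (v : ι → ℂ) :
    sandwich A⁻¹ (A *ᵥ v) = sandwich A v := by
  have hinv : A⁻¹ *ᵥ A *ᵥ v = v := by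
    rw [Matrix.mulVec_mulVec, Matrix.nonsing_inv_mul _ ((Matrix.isUnit_iff_isUnit_det _).mp
      hA.isUnit), Matrix.one_mulVec]
  rw [sandwich, hinv, Matrix.star_mulVec, hA.1.eq, ← Matrix.dotProduct_mulVec, sandwich]

theorem exists_re_sandwich_smul_eq {A : Matrix ι ι ℂ} (hA : A.PosDef) {v : ι → ℂ} (hv : v ≠ 0)
    {t : ℝ} (ht : 0 ≤ t) : ∃ r : ℝ, (sandwich A (r • v)).re = t := by
  have hpos : 0 < (sandwich A v).re := hA.re_dotProduct_pos hv
  refine ⟨√(t / (sandwich A v).re), ?_⟩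
  simp only [sandwich, Matrix.mulVec_smul, star_smul, star_trivial, smul_dotProduct,
    dotProduct_smul, smul_smul, Complex.smul_re, smul_eq_mul]
  rw [Real.mul_self_sqrt (by positivity), ← sandwich, div_mul_cancel₀ _ hpos.ne']

theorem strictConvexOn_re_sandwich {Q : Matrix ι ι ℂ} (hQ : Q.PosDef) :
    StrictConvexOn ℝ Set.univ fun v => (sandwich Q v).re := by
  refine ⟨convex_univ, fun x _ y _ hxy a b ha hb hab => ?_⟩
  have hpos : 0 < a * b * (sandwich Q (x - y)).re :=
    mul_pos (mul_pos ha hb) (hQ.re_dotProduct_pos (sub_ne_zero.mpr hxy))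
  have hexpand : (sandwich Q (a • x + b • y)).re =
      a * (sandwich Q x).re + b * (sandwich Q y).re - a * b * (sandwich Q (x - y)).re := by
    obtain rfl : b = 1 - a := by linarith
    simp only [sandwich, Matrix.mulVec_add, Matrix.mulVec_sub, Matrix.mulVec_smul, star_add,
      star_sub, star_smul, star_trivial, add_dotProduct, sub_dotProduct, dotProduct_add,
      dotProduct_sub, smul_dotProduct, dotProduct_smul, Complex.add_re, Complex.sub_re,
      Complex.smul_re, smul_eq_mul]
    ring
  simp only [smul_eq_mul, hexpand]
  linarith

theorem vecMulVec_mulVec_le_smul {K : Matrix ι ι ℂ} (hK : K.PosSemidef) (v : ι → ℂ) :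
    Matrix.vecMulVec (K *ᵥ v) (star (K *ᵥ v)) ≤ (sandwich K v).re • K := by
  let := K.toSeminormedAddCommGroup hK
  let := K.toInnerProductSpace hK
  have hinner (x y : ι → ℂ) : inner ℂ x y = star x ⬝ᵥ K *ᵥ y := dotProduct_comm _ _
  refine Matrix.le_iff.mpr (.of_dotProduct_mulVec_nonneg
    ((hK.1.smul (.all _)).sub (Matrix.posSemidef_vecMulVec_self_star _).1) fun x => ?_)
  have hCS : ‖inner ℂ v x‖ ^ 2 ≤ (sandwich K v).re * (sandwich K x).re := by
    have h := inner_mul_inner_self_le (𝕜 := ℂ) v x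
    rwa [norm_inner_symm x v, ← sq, hinner v v, hinner x x] at h
  have hquad : star x ⬝ᵥ ((sandwich K v).re • K -
      Matrix.vecMulVec (K *ᵥ v) (star (K *ᵥ v))) *ᵥ x =
        (((sandwich K v).re * (sandwich K x).re - ‖inner ℂ v x‖ ^ 2 : ℝ) : ℂ) := by
    have hsymm : star (K *ᵥ v) ⬝ᵥ x = inner ℂ v x := by
      rw [hinner, Matrix.star_mulVec, hK.1.eq, Matrix.dotProduct_mulVec]
    rw [Matrix.sub_mulVec, dotProduct_sub, Matrix.smul_mulVec, dotProduct_smul,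
      Matrix.vecMulVec_mulVec, op_smul_eq_smul, dotProduct_smul, hsymm, ← hinner x v,
      smul_eq_mul, ← inner_conj_symm x v, Complex.mul_conj', ← sandwich, sandwich_eq_ofReal hK.1 x,
      Complex.real_smul]
    push_cast
    rfl
  rw [hquad]
  exact_mod_cast sub_nonneg.mpr hCS

open scoped Matrix.Norms.L2Operator in
theorem eventually_posSemidef_of_posDef {M : Matrix ι ι ℂ} (hM : M.PosDef) :
    ∀ᶠ N in 𝓝 M, N.IsHermitian → N.PosSemidef := by
  classical
  exact (eventually_nonneg_of_isStrictlyPositive hM.isStrictlyPositive).mono fun _ hN h =>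
    Matrix.nonneg_iff_posSemidef.mp (hN h)

theorem isMaxEigenvalue_vecMulVec [DecidableEq ι] {x y : ι → ℂ} {l : ℝ} (hx : x ≠ 0)
    (hl : y ⬝ᵥ x = l) (hl0 : 0 ≤ l) : IsMaxEigenvalue (Matrix.vecMulVec x y) l := by
  have happly (v : ι → ℂ) : Matrix.toLin' (Matrix.vecMulVec x y) v = (y ⬝ᵥ v) • x := by
    rw [Matrix.toLin'_apply, Matrix.vecMulVec_mulVec, op_smul_eq_smul]
  refine ⟨Module.End.hasEigenvalue_of_hasEigenvector (x := x)
    (Module.End.hasEigenvector_iff.mpr ⟨Module.End.mem_eigenspace_iff.mpr ?_, hx⟩), fun z hz => ?_⟩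
  · rw [happly, hl]
  obtain ⟨v, hv⟩ := hz.exists_hasEigenvector
  have hzv : (y ⬝ᵥ v) • x = z • v := (happly v).symm.trans hv.apply_eq_smul
  obtain hyv | hyv := eq_or_ne (y ⬝ᵥ v) 0
  · have hz0 : z = 0 := by simpa [hyv, hv.2] using hzv.symm
    simp [hz0, hl0]
  · have hzl : z = l := by
      have := congrArg (y ⬝ᵥ ·) hzv
      simp only [dotProduct_smul, hl, smul_eq_mul, mul_comm z] at this
      exact (mul_left_cancel₀ hyv this).symm
    simp [hzl]

end QuadraticForms

section Contractions

variable {ι : Type*} [Fintype ι]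

theorem nonneg_of_mulVec_eq_smul {K : Matrix ι ι ℂ} (hK : K.PosSemidef) {v : ι → ℂ} (hv : v ≠ 0)
    {t : ℝ} (h : K *ᵥ v = t • v) : 0 ≤ t := by
  obtain ⟨n, hn, hvn⟩ := exists_pos_dotProduct_star_self_eq hv
  have h0 := hK.dotProduct_mulVec_nonneg v
  rw [h, dotProduct_smul, hvn, Complex.real_smul] at h0
  exact nonneg_of_mul_nonneg_left (by exact_mod_cast h0) hn

theorem conjTranspose_mul_self_add_smul_vecMulVec {A : Matrix ι ι ℂ} {σ n : ℝ} {v w : ι → ℂ}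
    (hAw : Aᴴ *ᵥ w = σ • v) (hw : star w ⬝ᵥ w = n) (c : ℝ) :
    (A + c • Matrix.vecMulVec w (star v))ᴴ * (A + c • Matrix.vecMulVec w (star v)) =
      Aᴴ * A + (2 * c * σ + c ^ 2 * n) • Matrix.vecMulVec v (star v) := by
  have hwA : star w ᵥ* A = σ • star v := by
    simpa [Matrix.star_mulVec] using congrArg star hAw
  have hadj : (A + c • Matrix.vecMulVec w (star v))ᴴ = Aᴴ + c • Matrix.vecMulVec v (star w) := by
    rw [Matrix.conjTranspose_add, Matrix.conjTranspose_smul, star_trivial,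
      Matrix.conjTranspose_vecMulVec, star_star]
  rw [hadj, Matrix.add_mul, Matrix.mul_add, Matrix.mul_add]
  simp only [Matrix.smul_mul, Matrix.mul_smul, Matrix.vecMulVec_mul_vecMulVec, hw]
  rw [Matrix.mul_vecMulVec, Matrix.vecMulVec_mul, hAw, hwA]
  simp only [Matrix.vecMulVec_smul, Matrix.smul_vecMulVec, Complex.coe_smul]
  module

theorem smul_vecMulVec_le_of_mulVec_eq_smul {K : Matrix ι ι ℂ} (hK : K.PosSemidef) {v : ι → ℂ}
    {t n : ℝ} (ht : 0 < t) (hn : 0 < n) (hvn : star v ⬝ᵥ v = n) (hKv : K *ᵥ v = t • v) :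
    (t / n) • Matrix.vecMulVec v (star v) ≤ K := by
  have h := vecMulVec_mulVec_le_smul hK v
  rw [sandwich, hKv, dotProduct_smul, hvn, Complex.real_smul, ← Complex.ofReal_mul,
    Complex.ofReal_re, star_smul, star_trivial, Matrix.vecMulVec_smul, Matrix.smul_vecMulVec,
    smul_smul, ← inv_smul_le_iff_of_pos (mul_pos ht hn), smul_smul] at h
  rwa [show t / n = (t * n)⁻¹ * (t * t) by field_simp]

theorem exists_conjTranspose_mulVec_eq_smul {A : Matrix ι ι ℂ} {σ : ℝ} {v : ι → ℂ} (hv : v ≠ 0)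
    (hσ : (Aᴴ * A) *ᵥ v = (σ ^ 2) • v) :
    ∃ w, Aᴴ *ᵥ w = σ • v ∧ star w ⬝ᵥ w = star v ⬝ᵥ v := by
  classical
  obtain rfl | hσ0 := eq_or_ne σ 0
  · have hdet : Aᴴ.det = 0 := by
      have h : (Aᴴ * A).det = 0 :=
        Matrix.exists_mulVec_eq_zero_iff.mp ⟨v, hv, by simpa using hσ⟩
      simpa [Matrix.det_mul] using h
    obtain ⟨w, hw, hAw⟩ := Matrix.exists_mulVec_eq_zero_iff.mpr hdet
    obtain ⟨n, hn, hvn⟩ := exists_pos_dotProduct_star_self_eq hv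
    obtain ⟨m, hm, hwm⟩ := exists_pos_dotProduct_star_self_eq hw
    refine ⟨√(n / m) • w, by simp [Matrix.mulVec_smul, hAw], ?_⟩
    rw [star_smul, star_trivial, smul_dotProduct, dotProduct_smul, smul_smul, hwm, hvn,
      Real.mul_self_sqrt (by positivity), Complex.real_smul, ← Complex.ofReal_mul,
      div_mul_cancel₀ _ hm.ne']
  · refine ⟨σ⁻¹ • A *ᵥ v, ?_, ?_⟩
    · rw [Matrix.mulVec_smul, Matrix.mulVec_mulVec, hσ, smul_smul]
      congr 1
      field_simp
    · have h : star (A *ᵥ v) ⬝ᵥ A *ᵥ v = (σ ^ 2) • (star v ⬝ᵥ v) := by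
        rw [Matrix.star_mulVec, ← Matrix.dotProduct_mulVec, Matrix.mulVec_mulVec, hσ,
          dotProduct_smul]
      rw [star_smul, star_trivial, smul_dotProduct, dotProduct_smul, h, smul_smul, smul_smul]
      field_simp
      simp

variable [DecidableEq ι]

section Compactness

open scoped Matrix.Norms.L2Operator

theorem isCompact_setOf_conjTranspose_mul_self_le_one :
    IsCompact {A : Matrix ι ι ℂ | Aᴴ * A ≤ 1} := by
  have hball : {A : Matrix ι ι ℂ | Aᴴ * A ≤ 1} = Metric.closedBall 0 1 := by
    ext A
    rw [Set.mem_ofPred_eq, mem_closedBall_zero_iff, ← Matrix.star_eq_conjTranspose,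
      ← CStarAlgebra.norm_le_one_iff_of_nonneg _ (star_mul_self_nonneg A),
      CStarRing.norm_star_mul_self, ← sq, sq_le_one_iff₀ (norm_nonneg A)]
  have : ProperSpace (Matrix ι ι ℂ) := FiniteDimensional.proper ℂ _
  exact hball ▸ isCompact_closedBall 0 1

end Compactness

theorem exists_mulVec_eq_smul_of_conjTranspose_mul_self_lt_one {A : Matrix ι ι ℂ}
    (hA : Aᴴ * A < 1) :
    ∃ (v : ι → ℂ) (σ n : ℝ), 0 ≤ σ ∧ σ < 1 ∧ 0 < n ∧ star v ⬝ᵥ v = n ∧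
      (Aᴴ * A) *ᵥ v = (σ ^ 2) • v ∧
      ((1 - σ ^ 2) / n) • Matrix.vecMulVec v (star v) ≤ 1 - Aᴴ * A := by
  have hP : (1 - Aᴴ * A).PosSemidef := Matrix.le_iff.mp hA.le
  obtain ⟨v, t, ht, hv, hPv⟩ := hP.1.exists_eigenvector_of_ne_zero (sub_ne_zero.mpr hA.ne')
  have hAv : (Aᴴ * A) *ᵥ v = (1 - t) • v := by
    rw [sub_smul, one_smul, ← hPv, Matrix.sub_mulVec, Matrix.one_mulVec, sub_sub_cancel]
  have ht0 : 0 < t := (nonneg_of_mulVec_eq_smul hP hv hPv).lt_of_ne' ht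
  have ht1 : 0 ≤ 1 - t :=
    nonneg_of_mulVec_eq_smul (Matrix.posSemidef_conjTranspose_mul_self A) hv hAv
  obtain ⟨n, hn, hvn⟩ := exists_pos_dotProduct_star_self_eq hv
  refine ⟨v, √(1 - t), n, Real.sqrt_nonneg _, ?_, hn, hvn, ?_, ?_⟩
  · rw [Real.sqrt_lt' one_pos]
    linarith
  · rw [Real.sq_sqrt ht1, hAv]
  · rw [Real.sq_sqrt ht1, sub_sub_cancel]
    exact smul_vecMulVec_le_of_mulVec_eq_smul hP ht0 hn hvn hPv

-- With `B = ((1 - σ) / |v|²) w v*`, where `Aᴴ w = σ v`, both `A + B` and `A - B` are contractions.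
theorem conjTranspose_mul_self_eq_one_of_mem_extremePoints {A : Matrix ι ι ℂ}
    (hA : A ∈ {A : Matrix ι ι ℂ | Aᴴ * A ≤ 1}.extremePoints ℝ) : Aᴴ * A = 1 := by
  by_contra hne
  obtain ⟨v, σ, n, hσ0, hσ1, hn, hvn, hAv, hle⟩ :=
    exists_mulVec_eq_smul_of_conjTranspose_mul_self_lt_one (lt_of_le_of_ne hA.1 hne)
  have hv : v ≠ 0 := by
    rintro rfl
    simp [eq_comm, hn.ne'] at hvn
  obtain ⟨w, hAw, hwv⟩ := exists_conjTranspose_mulVec_eq_smul hv hAv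
  have hw : w ≠ 0 := by
    rintro rfl
    exact hv (dotProduct_star_self_eq_zero.mp (by simpa using hwv.symm))
  have hmem {c : ℝ} (hc : 2 * c * σ + c ^ 2 * n ≤ (1 - σ ^ 2) / n) :
      A + c • Matrix.vecMulVec w (star v) ∈ {A : Matrix ι ι ℂ | Aᴴ * A ≤ 1} := by
    rw [Set.mem_ofPred_eq, conjTranspose_mul_self_add_smul_vecMulVec hAw (hwv.trans hvn),
      ← le_sub_iff_add_le']
    exact (smul_le_smul_of_nonneg_right hc
      (Matrix.posSemidef_vecMulVec_self_star v).nonneg).trans hle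
  have hfixed : A + ((1 - σ) / n) • Matrix.vecMulVec w (star v) = A := by
    refine hA.2 (hmem ?_) (hmem (c := -((1 - σ) / n)) ?_)
      ⟨1 / 2, 1 / 2, by norm_num, by norm_num, by norm_num, by module⟩
    · field_simp
      linarith
    · field_simp
      nlinarith
  simp [hv, hw, hn.ne', sub_ne_zero.mpr hσ1.ne'] at hfixed

end Contractions

section Boundariness

variable {V : Type*} [AddCommGroup V] [Module ℝ V] [TopologicalSpace V] {B : Set V} {y : V}

theorem exists_eq_smul_add_smul_of_mem_boundaryWeights (hB : Convex ℝ B) {w : ℝ}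
    (hw : w ∈ boundaryWeights B y) :
    w ∈ Set.Icc 0 1 ∧ ∃ x ∈ relBoundary B, ∃ z ∈ B, y = w • x + (1 - w) • z := by
  obtain ⟨m, p, x, hp, hsum, hx, rfl, ⟨j, rfl⟩, -⟩ := hw
  refine ⟨hp j, x j, hx j, ?_⟩
  have hrest : ∑ i ∈ Finset.univ.erase j, p i = 1 - p j := by
    rw [Finset.sum_erase_eq_sub (Finset.mem_univ j), hsum]
  rw [← Finset.add_sum_erase _ _ (Finset.mem_univ j)]
  obtain hj | hj := (hp j).2.eq_or_lt
  · have hzero : ∀ i ∈ Finset.univ.erase j, p i = 0 :=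
      (Finset.sum_eq_zero_iff_of_nonneg fun i _ => (hp i).1).mp (by rw [hrest, hj, sub_self])
    refine ⟨x j, (hx j).1, ?_⟩
    rw [Finset.sum_eq_zero fun i hi => by rw [hzero i hi, zero_smul], hj, sub_self, zero_smul]
  · have hj' : 0 < 1 - p j := sub_pos.mpr hj
    refine ⟨(Finset.univ.erase j).centerMass p x, hB.centerMass_mem (fun i _ => (hp i).1)
      (hrest ▸ hj') fun i _ => (hx i).1, ?_⟩
    rw [Finset.centerMass, hrest, smul_inv_smul₀ hj'.ne']

theorem boundariness_eq_of_forall_le (hB : Convex ℝ B) {b : ℝ} (hb0 : 0 ≤ b)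
    (hle : ∀ x ∈ relBoundary B, ∀ z ∈ B, ∀ t ∈ Set.Icc (0 : ℝ) 1,
      y = (1 - t) • x + t • z → b ≤ t)
    (hattained : b = 1 ∨ ∃ x ∈ relBoundary B, ∃ z ∈ relBoundary B,
      y = (1 - b) • x + b • z) (hb1 : b ≤ 1) :
    boundariness B y = b := by
  have hbound {w : ℝ} (hw : w ∈ boundaryWeights B y) : w ≤ 1 - b := by
    obtain ⟨hw01, x, hx, z, hz, hy⟩ := exists_eq_smul_add_smul_of_mem_boundaryWeights hB hw
    have := hle x hx z hz (1 - w) ⟨by linarith [hw01.2], by linarith [hw01.1]⟩ (by simpa using hy)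
    linarith
  suffices h : sSup (boundaryWeights B y) = 1 - b by rw [boundariness, h, sub_sub_cancel]
  obtain rfl | ⟨x, hx, z, hz, hy⟩ := hattained
  · have hnonpos : sSup (boundaryWeights B y) ≤ 0 :=
      Real.sSup_nonpos fun w hw => (hbound hw).trans_eq (sub_self 1)
    rw [sub_self]
    exact hnonpos.antisymm <| Real.sSup_nonneg fun w hw =>
      (exists_eq_smul_add_smul_of_mem_boundaryWeights hB hw).1.1
  · have hmax : max (1 - b) b ∈ boundaryWeights B y := by
      refine ⟨2, ![1 - b, b], ![x, z], ?_, by simp, ?_, by simpa using hy, ?_⟩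
      · simp [Fin.forall_fin_two, *]
      · simp [Fin.forall_fin_two, *]
      · simpa [Matrix.range_cons, Set.pair_comm] using! isGreatest_pair (a := 1 - b) (b := b)
    have hmax_eq : max (1 - b) b = 1 - b := (hbound hmax).antisymm (le_max_left _ _)
    exact IsGreatest.csSup_eq ⟨hmax_eq ▸ hmax, fun w hw => hbound hw⟩

end Boundariness

section PartialTrace

variable {m n R : Type*} [Fintype m] [Semiring R]

/-- The partial trace of a matrix on a tensor product over the first factor. -/
def partialTrace : Matrix (m × n) (m × n) R →ₗ[R] Matrix n n R where
  toFun M := ∑ a, M.submatrix (Prod.mk a) (Prod.mk a)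
  map_add' M N := by simp [Matrix.submatrix_add, Finset.sum_add_distrib]
  map_smul' c M := by simp [Matrix.submatrix_smul, Finset.smul_sum]

theorem partialTrace_apply (M : Matrix (m × n) (m × n) R) (j k : n) :
    partialTrace M j k = ∑ a, M (a, j) (a, k) :=
  Matrix.sum_apply j k _ _

theorem partialTrace_one [DecidableEq m] [DecidableEq n] :
    partialTrace (1 : Matrix (m × n) (m × n) R) = (Fintype.card m : R) • (1 : Matrix n n R) := by
  ext j k
  simp [partialTrace_apply, Matrix.one_apply]

theorem trace_partialTrace [Fintype n] (M : Matrix (m × n) (m × n) R) :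
    (partialTrace M).trace = M.trace := by
  simp only [Matrix.trace, Matrix.diag_apply, partialTrace_apply, Fintype.sum_prod_type]
  exact Finset.sum_comm

theorem posSemidef_partialTrace {M : Matrix (m × n) (m × n) ℂ} (hM : M.PosSemidef) :
    (partialTrace M).PosSemidef :=
  Matrix.posSemidef_sum _ fun _ _ => hM.submatrix _

theorem partialTrace_mono : Monotone (partialTrace (m := m) (n := n) (R := ℂ)) :=
  fun M N h => Matrix.le_iff.mpr <|
    map_sub partialTrace N M ▸ posSemidef_partialTrace (Matrix.le_iff.mp h)

end PartialTrace

section Choi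

variable {d : ℕ}

theorem vecOf_apply (A : Op d) (p : Fin d × Fin d) : vecOf A p = A p.1 p.2 := by
  simp [vecOf, Matrix.mulVec_sum, Finset.sum_apply, Matrix.kroneckerMap_apply, Matrix.one_apply]

/-- The vectorization `A ↦ |A⟩⟩` as a linear equivalence. -/
def vecLinearEquiv (d : ℕ) : Op d ≃ₗ[ℂ] (Fin d × Fin d → ℂ) where
  toFun := vecOf
  invFun v := Matrix.of fun a j => v (a, j)
  map_add' A B := by ext; simp [vecOf_apply]
  map_smul' c A := by ext; simp [vecOf_apply]
  left_inv A := by ext; simp [vecOf_apply]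
  right_inv v := by ext; simp [vecOf_apply]

theorem vecOf_add (A B : Op d) : vecOf (A + B) = vecOf A + vecOf B :=
  map_add (vecLinearEquiv d) A B

theorem vecOf_smul (r : ℝ) (A : Op d) : vecOf (r • A) = r • vecOf A :=
  (vecLinearEquiv d).toLinearMap.map_smul_of_tower r A

theorem vecOf_eq_zero_iff {A : Op d} : vecOf A = 0 ↔ A = 0 :=
  (vecLinearEquiv d).map_eq_zero_iff

theorem vecOf_surjective : Function.Surjective (vecOf (d := d)) :=
  (vecLinearEquiv d).surjective

theorem choi_apply (Φ : SuperOp d) (a j b k : Fin d) :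
    choi Φ (a, j) (b, k) = (1 / (d : ℂ)) * Φ (Matrix.single j k 1) a b := by
  simp [choi, Matrix.sum_apply, Matrix.kroneckerMap_apply, Matrix.single_apply, ite_and]

/-- The Choi–Jamiołkowski isomorphism `Φ ↦ J_Φ` as a linear map. -/
noncomputable def choiLinearMap (d : ℕ) :
    SuperOp d →ₗ[ℂ] Matrix (Fin d × Fin d) (Fin d × Fin d) ℂ where
  toFun := choi
  map_add' Φ Ψ := by
    ext ⟨a, j⟩ ⟨b, k⟩
    simp [choi_apply, mul_add]
  map_smul' c Φ := by
    ext ⟨a, j⟩ ⟨b, k⟩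
    simp [choi_apply, mul_left_comm]

theorem choi_add (Φ Ψ : SuperOp d) : choi (Φ + Ψ) = choi Φ + choi Ψ :=
  map_add (choiLinearMap d) Φ Ψ

theorem choi_sub (Φ Ψ : SuperOp d) : choi (Φ - Ψ) = choi Φ - choi Ψ :=
  map_sub (choiLinearMap d) Φ Ψ

theorem choi_smul (r : ℝ) (Φ : SuperOp d) : choi (r • Φ) = r • choi Φ :=
  (choiLinearMap d).map_smul_of_tower r Φ

theorem choi_sum {ι : Type*} (s : Finset ι) (Φ : ι → SuperOp d) :
    choi (∑ i ∈ s, Φ i) = ∑ i ∈ s, choi (Φ i) :=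
  map_sum (choiLinearMap d) Φ s

theorem continuous_choi : Continuous (choi (d := d)) :=
  (choiLinearMap d).continuous_of_finiteDimensional

theorem choi_injective [NeZero d] : Function.Injective (choi (d := d)) := by
  intro Φ Ψ h
  refine ContinuousLinearMap.coe_injective (Matrix.ext_linearMap ℂ fun j k => ?_)
  ext a b
  have hab := congrFun₂ h (a, j) (b, k)
  rw [choi_apply, choi_apply] at hab
  simpa [NeZero.ne d, Matrix.singleLinearMap] using hab

theorem choi_conjMap (A : Op d) :
    choi (conjMap A) = (1 / (d : ℝ)) • Matrix.vecMulVec (vecOf A) (star (vecOf A)) := by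
  ext ⟨a, j⟩ ⟨b, k⟩
  simp [choi_apply, conjMap, vecOf_apply, Matrix.vecMulVec_apply, Matrix.mul_apply,
    Matrix.single_apply, ite_and]

theorem partialTrace_vecMulVec_vecOf (A : Op d) :
    partialTrace (Matrix.vecMulVec (vecOf A) (star (vecOf A))) = (Aᴴ * A)ᵀ := by
  ext j k
  simp [partialTrace_apply, Matrix.vecMulVec_apply, vecOf_apply, Matrix.mul_apply, mul_comm]

theorem partialTrace_choi_conjMap (A : Op d) :
    partialTrace (choi (conjMap A)) = (1 / (d : ℝ)) • (Aᴴ * A)ᵀ := by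
  rw [choi_conjMap, LinearMap.map_smul_of_tower, partialTrace_vecMulVec_vecOf]

theorem posSemidef_choi_conjMap (A : Op d) : (choi (conjMap A)).PosSemidef := by
  rw [choi_conjMap]
  exact (Matrix.posSemidef_vecMulVec_self_star _).smul (by positivity)

theorem conjMap_smul (r : ℝ) (A : Op d) : conjMap (r • A) = (r ^ 2) • conjMap A := by
  ext X
  simp [conjMap, sq, smul_smul]

theorem posSemidef_choi_iff [NeZero d] {Φ : SuperOp d} :
    (choi Φ).PosSemidef ↔ ∃ (m : ℕ) (A : Fin m → Op d), Φ = ∑ l, conjMap (A l) := by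
  constructor
  · intro h
    obtain ⟨m, v, hv⟩ := Matrix.posSemidef_iff_eq_sum_vecMulVec.mp h
    choose B hB using fun l => vecOf_surjective (v l)
    refine ⟨m, fun l => √d • B l, choi_injective ?_⟩
    simp only [choi_sum, conjMap_smul, choi_smul, choi_conjMap, hB, hv]
    simp [Real.sq_sqrt, NeZero.ne d]
  · rintro ⟨m, A, rfl⟩
    rw [choi_sum]
    exact Matrix.posSemidef_sum _ fun l _ => posSemidef_choi_conjMap (A l)

theorem mem_channels_iff_exists_eq_sum_conjMap {Φ : SuperOp d} :
    Φ ∈ channels d ↔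
      ∃ (m : ℕ) (A : Fin m → Op d), ∑ l, (A l)ᴴ * A l = 1 ∧ Φ = ∑ l, conjMap (A l) := by
  simp [channels, ContinuousLinearMap.ext_iff, conjMap]

theorem mem_channels_iff_posSemidef_choi [NeZero d] {Φ : SuperOp d} :
    Φ ∈ channels d ↔
      (choi Φ).PosSemidef ∧ partialTrace (choi Φ) = (1 / (d : ℝ)) • (1 : Op d) := by
  have hd : (1 / (d : ℝ)) ≠ 0 := one_div_ne_zero (NeZero.ne _)
  have htrace {m : ℕ} (A : Fin m → Op d) :
      partialTrace (choi (∑ l, conjMap (A l))) = (1 / (d : ℝ)) • (1 : Op d) ↔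
        ∑ l, (A l)ᴴ * A l = 1 := by
    simp only [choi_sum, map_sum, partialTrace_choi_conjMap, ← Finset.smul_sum,
      ← Matrix.transpose_sum]
    rw [smul_right_inj hd, Matrix.transpose_eq_one]
  rw [mem_channels_iff_exists_eq_sum_conjMap, posSemidef_choi_iff]
  constructor
  · rintro ⟨m, A, hA, rfl⟩
    exact ⟨⟨m, A, rfl⟩, (htrace A).mpr hA⟩
  · rintro ⟨⟨m, A, rfl⟩, hA⟩
    exact ⟨m, A, (htrace A).mp hA, rfl⟩

theorem trace_choi_of_mem_channels [NeZero d] {Φ : SuperOp d} (h : Φ ∈ channels d) :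
    (choi Φ).trace = 1 := by
  rw [← trace_partialTrace, (mem_channels_iff_posSemidef_choi.mp h).2]
  simp [NeZero.ne d]

theorem conjMap_mem_channels (U : Matrix.unitaryGroup (Fin d) ℂ) :
    conjMap (U : Op d) ∈ channels d :=
  mem_channels_iff_exists_eq_sum_conjMap.mpr
    ⟨1, fun _ => U, by
      simpa [Matrix.star_eq_conjTranspose] using
        Matrix.mem_unitaryGroup_iff'.mp U.2, by simp⟩

theorem convex_channels [NeZero d] : Convex ℝ (channels d) := by
  intro Φ hΦ Ψ hΨ a b ha hb hab
  rw [mem_channels_iff_posSemidef_choi] at *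
  refine ⟨?_, ?_⟩
  · rw [choi_add, choi_smul, choi_smul]
    exact (hΦ.1.smul ha).add (hΨ.1.smul hb)
  · rw [choi_add, choi_smul, choi_smul, map_add, LinearMap.map_smul_of_tower,
      LinearMap.map_smul_of_tower, hΦ.2, hΨ.2, ← add_smul, hab, one_smul]

end Choi

section ChannelBoundary

variable {d : ℕ}

instance : ContinuousSMul ℝ (SuperOp d) :=
  IsScalarTower.continuousSMul ℂ

/-- The completely depolarizing channel `ρ ↦ (tr ρ / d) I`, a reference point in the relative
interior of the set of channels. -/
noncomputable def depolarizing (d : ℕ) : SuperOp d :=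
  ((Matrix.traceLinearMap (Fin d) ℂ ℂ).smulRight
    ((1 / (d : ℂ)) • (1 : Op d))).toContinuousLinearMap

theorem choi_depolarizing (d : ℕ) :
    choi (depolarizing d) = ((1 / (d : ℝ)) ^ 2) •
      (1 : Matrix (Fin d × Fin d) (Fin d × Fin d) ℂ) := by
  ext ⟨a, j⟩ ⟨b, k⟩
  obtain rfl | hjk := eq_or_ne j k
  · obtain rfl | hab := eq_or_ne a b
    · simp [choi_apply, depolarizing, sq]
    · simp [choi_apply, depolarizing, hab]
  · simp [choi_apply, depolarizing, Matrix.trace_single_eq_of_ne, hjk]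

theorem depolarizing_mem_channels [NeZero d] : depolarizing d ∈ channels d := by
  rw [mem_channels_iff_posSemidef_choi, choi_depolarizing]
  refine ⟨Matrix.PosSemidef.one.smul (by positivity), ?_⟩
  rw [LinearMap.map_smul_of_tower, partialTrace_one, Fintype.card_fin, sq, mul_smul]
  congr 1
  ext
  simp [Matrix.one_apply, NeZero.ne d]

theorem posDef_choi_of_mem_intrinsicInterior [NeZero d] {F : SuperOp d}
    (hF : F ∈ intrinsicInterior ℝ (channels d)) : (choi F).PosDef := by
  obtain ⟨ε, hε, hmem⟩ := exists_pos_add_smul_sub_mem hF depolarizing_mem_channels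
  have hchoi : (1 + ε) • choi F = (ε * (1 / (d : ℝ)) ^ 2) • 1 +
      choi (F + ε • (F - depolarizing d)) := by
    rw [choi_add, choi_smul, choi_sub, choi_depolarizing]
    module
  have hd : (0 : ℝ) < d := Nat.cast_pos.mpr (NeZero.pos d)
  have hpos : ((1 + ε) • choi F).PosDef :=
    hchoi ▸ (Matrix.PosDef.one.smul (by positivity)).add_posSemidef
      (mem_channels_iff_posSemidef_choi.mp hmem).1
  simpa [inv_smul_smul₀ (by positivity : 1 + ε ≠ 0)] using
    hpos.smul (inv_pos.mpr (by positivity : 0 < 1 + ε))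

theorem isHermitian_and_partialTrace_choi_of_mem_affineSpan [NeZero d] {H : SuperOp d}
    (hH : H ∈ affineSpan ℝ (channels d)) :
    (choi H).IsHermitian ∧ partialTrace (choi H) = (1 / (d : ℝ)) • (1 : Op d) := by
  refine affineSpan_induction hH (fun Φ hΦ => ?_) fun c Φ Ψ Ξ hΦ hΨ hΞ => ?_
  · exact (mem_channels_iff_posSemidef_choi.mp hΦ).imp_left fun h => h.1
  · rw [vsub_eq_sub, vadd_eq_add, choi_add, choi_smul, choi_sub]
    refine ⟨((hΦ.1.sub hΨ.1).smul (.all c)).add hΞ.1, ?_⟩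
    rw [map_add, LinearMap.map_smul_of_tower, map_sub, hΦ.2, hΨ.2, hΞ.2, sub_self, smul_zero,
      zero_add]

theorem mem_intrinsicInterior_of_posDef_choi [NeZero d] {G : SuperOp d}
    (hG : G ∈ channels d) (hpos : (choi G).PosDef) : G ∈ intrinsicInterior ℝ (channels d) := by
  let G' : affineSpan ℝ (channels d) := ⟨G, subset_affineSpan ℝ _ hG⟩
  have hcont : Continuous fun H : affineSpan ℝ (channels d) => choi (H : SuperOp d) :=
    continuous_choi.comp continuous_subtype_val
  have hnhds := (hcont.tendsto G').eventually (eventually_posSemidef_of_posDef hpos)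
  refine mem_intrinsicInterior.mpr ⟨G', mem_interior_iff_mem_nhds.mpr ?_, rfl⟩
  filter_upwards [hnhds] with H hH
  obtain ⟨hherm, htrace⟩ := isHermitian_and_partialTrace_choi_of_mem_affineSpan H.2
  exact mem_channels_iff_posSemidef_choi.mpr ⟨hH hherm, htrace⟩

theorem mem_relBoundary_channels_iff [NeZero d] {G : SuperOp d} :
    G ∈ relBoundary (channels d) ↔ G ∈ channels d ∧ ∃ v ≠ 0, choi G *ᵥ v = 0 := by
  refine and_congr_right fun hG => ?_
  have hposDef : (choi G).PosDef ↔ G ∈ intrinsicInterior ℝ (channels d) :=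
    ⟨mem_intrinsicInterior_of_posDef_choi hG, posDef_choi_of_mem_intrinsicInterior⟩
  rw [Matrix.exists_mulVec_eq_zero_iff, ← hposDef,
    (mem_channels_iff_posSemidef_choi.mp hG).1.posDef_iff_det_ne_zero, not_not]

theorem one_lt_of_mem_relBoundary_channels [NeZero d] {G : SuperOp d}
    (hG : G ∈ relBoundary (channels d)) : 1 < d := by
  obtain ⟨hG, v, hv, hGv⟩ := mem_relBoundary_channels_iff.mp hG
  by_contra hd
  obtain rfl : d = 1 := by have := NeZero.pos d; omega
  have htrace := trace_choi_of_mem_channels hG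
  refine hv (funext fun i => ?_)
  have hi := congrFun hGv i
  simp_all [Matrix.trace, Matrix.mulVec, dotProduct, Fintype.sum_subsingleton _ i]

theorem conjMap_mem_relBoundary_channels (hd : 1 < d) (U : Matrix.unitaryGroup (Fin d) ℂ) :
    conjMap (U : Op d) ∈ relBoundary (channels d) := by
  have : NeZero d := ⟨by omega⟩
  have : Nontrivial (Fin d) := Fin.nontrivial_iff_two_le.mpr hd
  rw [mem_relBoundary_channels_iff, Matrix.exists_mulVec_eq_zero_iff, choi_conjMap,
    ← Matrix.smul_vecMulVec]
  exact ⟨conjMap_mem_channels U, Matrix.det_vecMulVec _ _⟩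

end ChannelBoundary

section VectorizedForm

variable {d : ℕ} {Q : Matrix (Fin d × Fin d) (Fin d × Fin d) ℂ} {A : Op d}

/-- The real quadratic form `A ↦ ⟨⟨A|Q|A⟩⟩` on operators attached to a Hermitian matrix `Q`. The
real part makes it real-valued; for Hermitian `Q` it discards nothing. -/
def vecForm (Q : Matrix (Fin d × Fin d) (Fin d × Fin d) ℂ) (A : Op d) : ℝ :=
  (sandwich Q (vecOf A)).re

theorem sandwich_vecOf_eq_vecForm (hQ : Q.IsHermitian) (A : Op d) :
    sandwich Q (vecOf A) = (vecForm Q A : ℂ) :=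
  sandwich_eq_ofReal hQ (vecOf A)

theorem vecForm_pos (hQ : Q.PosDef) (hA : A ≠ 0) : 0 < vecForm Q A :=
  hQ.re_dotProduct_pos (mt vecOf_eq_zero_iff.mp hA)

theorem inv_mulVec_vecOf_ne_zero (hQ : Q.PosDef) (hA : A ≠ 0) : Q⁻¹ *ᵥ vecOf A ≠ 0 := by
  intro h
  have hQA := mulVec_inv_mulVec hQ.isUnit (vecOf A)
  rw [h, Matrix.mulVec_zero] at hQA
  exact hA (vecOf_eq_zero_iff.mp hQA.symm)

theorem isMaxEigenvalue_inv_mul_choi_conjMap (hQ : Q.PosDef) (hA : A ≠ 0) :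
    IsMaxEigenvalue (Q⁻¹ * choi (conjMap A)) (vecForm Q⁻¹ A / d) := by
  rw [choi_conjMap, Matrix.mul_smul, Matrix.mul_vecMulVec, ← Matrix.vecMulVec_smul]
  refine isMaxEigenvalue_vecMulVec (inv_mulVec_vecOf_ne_zero hQ hA) ?_
    (div_nonneg (vecForm_pos hQ.inv hA).le d.cast_nonneg)
  rw [smul_dotProduct, ← sandwich, sandwich_vecOf_eq_vecForm hQ.inv.1, Complex.real_smul,
    ← Complex.ofReal_mul, one_div_mul_eq_div]

theorem continuous_vecForm (Q : Matrix (Fin d × Fin d) (Fin d × Fin d) ℂ) :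
    Continuous (vecForm Q) := by
  have hvec : Continuous (vecOf (d := d)) :=
    (vecLinearEquiv d).toLinearMap.continuous_of_finiteDimensional
  exact Complex.continuous_re.comp <|
    hvec.star.dotProduct (continuous_const.matrix_mulVec hvec)

theorem strictConvexOn_vecForm (hQ : Q.PosDef) : StrictConvexOn ℝ Set.univ (vecForm Q) := by
  refine ⟨convex_univ, fun A _ B _ hAB a b ha hb hab => ?_⟩
  have hne : vecOf A ≠ vecOf B := (vecLinearEquiv d).injective.ne hAB
  simpa only [vecForm, vecOf_add, vecOf_smul] using
    (strictConvexOn_re_sandwich hQ).2 (Set.mem_univ _) (Set.mem_univ _) hne ha hb hab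

theorem conjTranspose_mul_self_eq_one_of_isMaxOn_vecForm (hQ : Q.PosDef) (hA : Aᴴ * A ≤ 1)
    (hmax : IsMaxOn (vecForm Q) {B | Bᴴ * B ≤ 1} A) : Aᴴ * A = 1 :=
  conjTranspose_mul_self_eq_one_of_mem_extremePoints <|
    mem_extremePoints_of_isMaxOn (strictConvexOn_vecForm hQ) (Set.subset_univ _) hA hmax

theorem exists_unitary_isMaxOn_vecForm (hQ : Q.PosDef) :
    ∃ U : Matrix.unitaryGroup (Fin d) ℂ, IsMaxOn (vecForm Q) {A | Aᴴ * A ≤ 1} (U : Op d) := by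
  obtain ⟨A, hA, hmax⟩ := isCompact_setOf_conjTranspose_mul_self_le_one.exists_isMaxOn
    ⟨0, by simp [zero_le_one]⟩ (continuous_vecForm Q).continuousOn
  exact ⟨⟨A, Matrix.mem_unitaryGroup_iff'.mpr
    (conjTranspose_mul_self_eq_one_of_isMaxOn_vecForm hQ hA hmax)⟩, hmax⟩

theorem vecForm_unitary_le_of_isMaxOn {U : Op d}
    (hmax : IsMaxOn (vecForm Q) {A | Aᴴ * A ≤ 1} U) (W : Matrix.unitaryGroup (Fin d) ℂ) :
    vecForm Q W ≤ vecForm Q U :=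
  hmax (Matrix.mem_unitaryGroup_iff'.mp W.2).le

end VectorizedForm

section Domination

variable {d : ℕ} [NeZero d] {J K : Matrix (Fin d × Fin d) (Fin d × Fin d) ℂ} {A : Op d} {b : ℝ}

theorem coe_unitary_ne_zero (U : Matrix.unitaryGroup (Fin d) ℂ) : (U : Op d) ≠ 0 :=
  fun h => zero_ne_one (α := Op d) (by simpa [h] using Matrix.UnitaryGroup.star_mul_self U)

theorem conjTranspose_mul_self_le_one_of_smul_choi_conjMap_le (hb : 0 < b)
    (hK : partialTrace K = (b / d) • (1 : Op d)) (h : b • choi (conjMap A) ≤ K) :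
    Aᴴ * A ≤ 1 := by
  have hbd : 0 < b / d := div_pos hb (Nat.cast_pos.mpr (NeZero.pos d))
  have htrace : (b / d) • (Aᴴ * A)ᵀ ≤ (b / d) • (1 : Op d) := by
    have h := partialTrace_mono h
    rwa [LinearMap.map_smul_of_tower, partialTrace_choi_conjMap, smul_smul, mul_one_div, hK] at h
  rw [smul_le_smul_iff_of_pos_left hbd] at htrace
  rw [Matrix.le_iff] at htrace ⊢
  simpa only [Matrix.transpose_sub, Matrix.transpose_one, Matrix.transpose_transpose] using
    htrace.transpose

theorem eq_smul_choi_conjMap_of_le (W : Matrix.unitaryGroup (Fin d) ℂ)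
    (hK : partialTrace K = (b / d) • (1 : Op d)) (h : b • choi (conjMap (W : Op d)) ≤ K) :
    K = b • choi (conjMap (W : Op d)) := by
  refine sub_eq_zero.mp ((Matrix.le_iff.mp h).trace_eq_zero_iff.mp ?_)
  rw [Matrix.trace_sub, Matrix.trace_smul, trace_choi_of_mem_channels (conjMap_mem_channels W),
    ← trace_partialTrace, hK]
  simp [NeZero.ne d]

theorem smul_choi_conjMap_le_of_vecOf_eq_mulVec (hK : K.PosSemidef) {v : Fin d × Fin d → ℂ}
    (hA : vecOf A = K *ᵥ v) (hb : 0 < b) (hv : (sandwich K v).re = d / b) :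
    b • choi (conjMap A) ≤ K := by
  have hd : (0 : ℝ) < d := Nat.cast_pos.mpr (NeZero.pos d)
  have h := smul_le_smul_of_nonneg_left (vecMulVec_mulVec_le_smul hK v) (div_pos hb hd).le
  rwa [← hA, hv, smul_smul, div_mul_div_cancel₀ hd.ne', div_self hb.ne', one_smul,
    ← mul_one_div, mul_smul, ← choi_conjMap] at h

theorem exists_contraction_smul_choi_conjMap_le (hJ : J.PosDef) (hK : K.PosSemidef)
    {v : Fin d × Fin d → ℂ} (hv : v ≠ 0) (hKv : K *ᵥ v = J *ᵥ v) (hb : 0 < b)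
    (htrace : partialTrace K = (b / d) • (1 : Op d)) :
    ∃ A : Op d, Aᴴ * A ≤ 1 ∧ b * (vecForm J⁻¹ A / d) = 1 ∧ b • choi (conjMap A) ≤ K := by
  have hd : (0 : ℝ) < d := Nat.cast_pos.mpr (NeZero.pos d)
  obtain ⟨r, hr⟩ := exists_re_sandwich_smul_eq hJ hv (div_pos hd hb).le
  have hKr : K *ᵥ (r • v) = J *ᵥ (r • v) := by simp only [Matrix.mulVec_smul, hKv]
  obtain ⟨A, hA⟩ := vecOf_surjective (J *ᵥ (r • v))
  have hle : b • choi (conjMap A) ≤ K :=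
    smul_choi_conjMap_le_of_vecOf_eq_mulVec hK (hA.trans hKr.symm) hb (by rwa [sandwich, hKr])
  refine ⟨A, conjTranspose_mul_self_le_one_of_smul_choi_conjMap_le hb htrace hle, ?_, hle⟩
  rw [vecForm, hA, sandwich_inv_mulVec hJ, hr]
  field_simp

theorem one_le_mul_vecForm_div_of_isMaxOn (hJ : J.PosDef) {U : Op d}
    (hmax : IsMaxOn (vecForm J⁻¹) {A | Aᴴ * A ≤ 1} U) (hK : K.PosSemidef)
    {v : Fin d × Fin d → ℂ} (hv : v ≠ 0) (hKv : K *ᵥ v = J *ᵥ v) (hb : 0 < b)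
    (htrace : partialTrace K = (b / d) • (1 : Op d)) : 1 ≤ b * (vecForm J⁻¹ U / d) := by
  obtain ⟨A, hA, hAb, -⟩ := exists_contraction_smul_choi_conjMap_le hJ hK hv hKv hb htrace
  rw [← hAb]
  gcongr
  exact hmax hA

theorem exists_unitary_eq_smul_choi_conjMap_of_isMaxOn (hJ : J.PosDef) {U : Op d}
    (hmax : IsMaxOn (vecForm J⁻¹) {A | Aᴴ * A ≤ 1} U) (hK : K.PosSemidef)
    {v : Fin d × Fin d → ℂ} (hv : v ≠ 0) (hKv : K *ᵥ v = J *ᵥ v) (hb : 0 < b)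
    (htrace : partialTrace K = (b / d) • (1 : Op d)) (hbU : b * (vecForm J⁻¹ U / d) = 1) :
    ∃ W : Matrix.unitaryGroup (Fin d) ℂ, K = b • choi (conjMap (W : Op d)) := by
  obtain ⟨A, hA, hAb, hle⟩ := exists_contraction_smul_choi_conjMap_le hJ hK hv hKv hb htrace
  have hAU : vecForm J⁻¹ A = vecForm J⁻¹ U :=
    (div_left_inj' (NeZero.ne (d : ℝ))).mp (mul_left_cancel₀ hb.ne' (hAb.trans hbU.symm))
  have hAmax : IsMaxOn (vecForm J⁻¹) {A | Aᴴ * A ≤ 1} A := fun B hB => (hmax hB).trans_eq hAU.symm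
  let W : Matrix.unitaryGroup (Fin d) ℂ := ⟨A, Matrix.mem_unitaryGroup_iff'.mpr
    (conjTranspose_mul_self_eq_one_of_isMaxOn_vecForm hJ.inv hA hAmax)⟩
  exact ⟨W, eq_smul_choi_conjMap_of_le W htrace hle⟩

theorem inv_smul_choi_conjMap_le (hJ : J.PosDef) (hA : A ≠ 0) :
    (vecForm J⁻¹ A / d)⁻¹ • choi (conjMap A) ≤ J := by
  have hpos := vecForm_pos hJ.inv hA
  have hJA : J *ᵥ J⁻¹ *ᵥ vecOf A = vecOf A := mulVec_inv_mulVec hJ.isUnit _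
  refine smul_choi_conjMap_le_of_vecOf_eq_mulVec hJ.posSemidef hJA.symm
    (inv_pos.mpr (div_pos hpos (Nat.cast_pos.mpr (NeZero.pos d)))) ?_
  rw [← sandwich_inv_mulVec hJ, hJA, div_inv_eq_mul, mul_div_cancel₀ _ (NeZero.ne (d : ℝ)), vecForm]

theorem inv_smul_choi_conjMap_mulVec (hJ : J.PosDef) (hA : A ≠ 0) :
    ((vecForm J⁻¹ A / d)⁻¹ • choi (conjMap A)) *ᵥ (J⁻¹ *ᵥ vecOf A) = vecOf A := by
  have hne := (vecForm_pos hJ.inv hA).ne'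
  have hd := NeZero.ne (d : ℝ)
  rw [choi_conjMap, smul_smul, Matrix.smul_mulVec, Matrix.vecMulVec_mulVec, op_smul_eq_smul,
    ← sandwich, sandwich_vecOf_eq_vecForm hJ.inv.1]
  rw [Complex.coe_smul, smul_smul, inv_div, div_mul_div_comm, mul_one, div_mul_cancel_right₀ hd,
    inv_mul_cancel₀ hne, one_smul]

end Domination

section ChannelDecomposition

variable {d : ℕ} [NeZero d] {F G E : SuperOp d} {t : ℝ}

theorem le_one_of_smul_choi_le (hF : F ∈ channels d) (hE : E ∈ channels d)
    (h : t • choi E ≤ choi F) : t ≤ 1 := by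
  have htrace := (Matrix.le_iff.mp h).trace_nonneg
  rw [Matrix.trace_sub, Matrix.trace_smul, trace_choi_of_mem_channels hF,
    trace_choi_of_mem_channels hE, Complex.real_smul, mul_one, sub_nonneg] at htrace
  exact_mod_cast htrace

theorem inv_smul_sub_smul_mem_channels (hF : F ∈ channels d) (hE : E ∈ channels d) (ht : t < 1)
    (h : t • choi E ≤ choi F) : (1 - t)⁻¹ • (F - t • E) ∈ channels d := by
  have ht' : 0 < 1 - t := sub_pos.mpr ht
  rw [mem_channels_iff_posSemidef_choi, choi_smul, choi_sub, choi_smul]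
  refine ⟨(Matrix.le_iff.mp h).smul (inv_pos.mpr ht').le, ?_⟩
  rw [LinearMap.map_smul_of_tower, map_sub, LinearMap.map_smul_of_tower,
    (mem_channels_iff_posSemidef_choi.mp hF).2, (mem_channels_iff_posSemidef_choi.mp hE).2]
  match_scalars
  field_simp

theorem inv_smul_sub_smul_mem_relBoundary (hF : F ∈ channels d) (hE : E ∈ channels d) (ht : t < 1)
    (h : t • choi E ≤ choi F) {v : Fin d × Fin d → ℂ} (hv : v ≠ 0)
    (hEv : (t • choi E) *ᵥ v = choi F *ᵥ v) :
    (1 - t)⁻¹ • (F - t • E) ∈ relBoundary (channels d) := by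
  refine mem_relBoundary_channels_iff.mpr ⟨inv_smul_sub_smul_mem_channels hF hE ht h, v, hv, ?_⟩
  rw [choi_smul, choi_sub, choi_smul, Matrix.smul_mulVec, Matrix.sub_mulVec, hEv, sub_self,
    smul_zero]

theorem exists_mulVec_smul_choi_eq (hG : G ∈ relBoundary (channels d))
    (h : F = (1 - t) • G + t • E) : ∃ v ≠ 0, (t • choi E) *ᵥ v = choi F *ᵥ v := by
  obtain ⟨-, v, hv, hGv⟩ := mem_relBoundary_channels_iff.mp hG
  refine ⟨v, hv, ?_⟩
  rw [h, choi_add, choi_smul, choi_smul, Matrix.add_mulVec, Matrix.smul_mulVec (1 - t), hGv,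
    smul_zero, zero_add]

theorem partialTrace_smul_choi_of_mem_channels (hE : E ∈ channels d) (t : ℝ) :
    partialTrace (t • choi E) = (t / d) • (1 : Op d) := by
  rw [LinearMap.map_smul_of_tower, (mem_channels_iff_posSemidef_choi.mp hE).2, smul_smul,
    mul_one_div]

theorem inv_vecForm_div_le_of_eq_smul_add_smul (hJ : (choi F).PosDef) {U : Op d}
    (hU : 0 < vecForm (choi F)⁻¹ U)
    (hmax : IsMaxOn (vecForm (choi F)⁻¹) {A | Aᴴ * A ≤ 1} U) (hG : G ∈ relBoundary (channels d))
    (hE : E ∈ channels d) (ht : 0 ≤ t) (h : F = (1 - t) • G + t • E) :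
    (vecForm (choi F)⁻¹ U / d)⁻¹ ≤ t := by
  obtain ⟨v, hv, hEv⟩ := exists_mulVec_smul_choi_eq hG h
  have ht' : 0 < t := by
    refine ht.lt_of_ne' ?_
    rintro rfl
    have hpos := hJ.dotProduct_mulVec_pos hv
    simp [← hEv] at hpos
  rw [inv_le_iff_one_le_mul₀ (div_pos hU (Nat.cast_pos.mpr (NeZero.pos d)))]
  exact one_le_mul_vecForm_div_of_isMaxOn hJ hmax
    ((mem_channels_iff_posSemidef_choi.mp hE).1.smul ht) hv hEv ht'
    (partialTrace_smul_choi_of_mem_channels hE t)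

theorem boundariness_channels_eq_inv (hF : F ∈ channels d) (hJ : (choi F).PosDef)
    {U : Matrix.unitaryGroup (Fin d) ℂ}
    (hmax : IsMaxOn (vecForm (choi F)⁻¹) {A | Aᴴ * A ≤ 1} (U : Op d)) :
    boundariness (channels d) F = (vecForm (choi F)⁻¹ U / d)⁻¹ := by
  have hU := coe_unitary_ne_zero U
  have hUc := conjMap_mem_channels U
  have hN := vecForm_pos hJ.inv hU
  have hle := inv_smul_choi_conjMap_le hJ hU
  have hker : ((vecForm (choi F)⁻¹ U / d)⁻¹ • choi (conjMap (U : Op d))) *ᵥ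
      ((choi F)⁻¹ *ᵥ vecOf U) = choi F *ᵥ ((choi F)⁻¹ *ᵥ vecOf U) :=
    (inv_smul_choi_conjMap_mulVec hJ hU).trans (mulVec_inv_mulVec hJ.isUnit _).symm
  have hb1 := le_one_of_smul_choi_le hF hUc hle
  refine boundariness_eq_of_forall_le convex_channels (by positivity)
    (fun G hG E hE t ht h => inv_vecForm_div_le_of_eq_smul_add_smul hJ hN hmax hG hE ht.1 h)
    (hb1.eq_or_lt.imp_right fun hlt => ?_) hb1
  have hG := inv_smul_sub_smul_mem_relBoundary hF hUc hlt hle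
    (inv_mulVec_vecOf_ne_zero hJ hU) hker
  refine ⟨_, hG, conjMap U,
    conjMap_mem_relBoundary_channels (one_lt_of_mem_relBoundary_channels hG) U, ?_⟩
  rw [smul_inv_smul₀ (sub_pos.mpr hlt).ne', sub_add_cancel]

theorem exists_unitary_eq_conjMap_of_eq_boundariness_smul_add (hF : F ∈ channels d)
    (hJ : (choi F).PosDef) (hE : E ∈ channels d) (hG : G ∈ relBoundary (channels d))
    (h : F = boundariness (channels d) F • E + (1 - boundariness (channels d) F) • G) :
    ∃ W : Matrix.unitaryGroup (Fin d) ℂ, E = conjMap (W : Op d) := by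
  obtain ⟨U, hmax⟩ := exists_unitary_isMaxOn_vecForm hJ.inv
  have hN : 0 < vecForm (choi F)⁻¹ U / d :=
    div_pos (vecForm_pos hJ.inv (coe_unitary_ne_zero U)) (Nat.cast_pos.mpr (NeZero.pos d))
  rw [boundariness_channels_eq_inv hF hJ hmax, add_comm] at h
  obtain ⟨v, hv, hEv⟩ := exists_mulVec_smul_choi_eq hG h
  obtain ⟨W, hW⟩ := exists_unitary_eq_smul_choi_conjMap_of_isMaxOn hJ hmax
    ((mem_channels_iff_posSemidef_choi.mp hE).1.smul (inv_pos.mpr hN).le) hv hEv (inv_pos.mpr hN)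
    (partialTrace_smul_choi_of_mem_channels hE _) (inv_mul_cancel₀ hN.ne')
  exact ⟨W, choi_injective (smul_right_injective _ (inv_pos.mpr hN).ne' hW)⟩

end ChannelDecomposition

theorem mainTheorem1 (d : ℕ) (hd : 0 < d) (F : SuperOp d)
    (hF : F ∈ intrinsicInterior ℝ (channels d)) :
    IsUnit (choi F) ∧
    (∃ lam : Matrix.unitaryGroup (Fin d) ℂ → ℝ,
      (∀ U : Matrix.unitaryGroup (Fin d) ℂ,
        IsMaxEigenvalue ((choi F)⁻¹ * choi (conjMap (U : Op d))) (lam U)) ∧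
      ∃ M : ℝ, IsGreatest (Set.range lam) M ∧ 0 < M ∧
        boundariness (channels d) F = M⁻¹) ∧
    (∃ q : Matrix.unitaryGroup (Fin d) ℂ → ℝ,
      (∀ U : Matrix.unitaryGroup (Fin d) ℂ,
        sandwich (choi F)⁻¹ (vecOf (U : Op d)) = (q U : ℂ)) ∧
      ∃ N : ℝ, IsGreatest (Set.range q) N ∧ 0 < N ∧
        boundariness (channels d) F = (d : ℝ) / N) ∧
    (∀ E ∈ channels d, ∀ G ∈ relBoundary (channels d),
      F = boundariness (channels d) F • E + (1 - boundariness (channels d) F) • G →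
      ∃ U : Matrix.unitaryGroup (Fin d) ℂ, E = conjMap (U : Op d)) := by
  have : NeZero d := ⟨hd.ne'⟩
  have hd' : (0 : ℝ) < d := Nat.cast_pos.mpr hd
  have hJ := posDef_choi_of_mem_intrinsicInterior hF
  have hFc : F ∈ channels d := intrinsicInterior_subset hF
  obtain ⟨U₀, hmax⟩ := exists_unitary_isMaxOn_vecForm hJ.inv
  have hb := boundariness_channels_eq_inv hFc hJ hmax
  have hN := vecForm_pos hJ.inv (coe_unitary_ne_zero U₀)
  have hgreatest : IsGreatest (Set.range fun U : Matrix.unitaryGroup (Fin d) ℂ =>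
      vecForm (choi F)⁻¹ U) (vecForm (choi F)⁻¹ U₀) :=
    ⟨⟨U₀, rfl⟩, Set.forall_mem_range.mpr (vecForm_unitary_le_of_isMaxOn hmax)⟩
  have hgreatest_div : IsGreatest (Set.range fun U : Matrix.unitaryGroup (Fin d) ℂ =>
      vecForm (choi F)⁻¹ U / d) (vecForm (choi F)⁻¹ U₀ / d) :=
    ⟨⟨U₀, rfl⟩, Set.forall_mem_range.mpr fun U =>
      div_le_div_of_nonneg_right (vecForm_unitary_le_of_isMaxOn hmax U) hd'.le⟩
  exact ⟨hJ.isUnit,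
    ⟨_, fun U => isMaxEigenvalue_inv_mul_choi_conjMap hJ (coe_unitary_ne_zero U), _,
      hgreatest_div, div_pos hN hd', hb⟩,
    ⟨_, fun U => sandwich_vecOf_eq_vecForm hJ.inv.1 U, _, hgreatest, hN, hb.trans (inv_div _ _)⟩,
    fun E hE G hG => exists_unitary_eq_conjMap_of_eq_boundariness_smul_add hFc hJ hE hG⟩
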